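/- **Setting.** Let $\mathcal V=(\mathcal V,\bigvee,\otimes,k)$ be a commutative unital quantale, with internal hom given by $x\otimes y\le z\iff x\le\hom(y,z)$. A *strict topological theory* $\mathcal T=(\mathbb T,\mathcal V,\xi)$ consists of a monad $\mathbb T=(T,m,e)$ on $\mathbf{Set}$, such a $\mathcal V$, and a map $\xi:T\mathcal V\to\mathcal V$ such that: $T$ sends pullbacks to weak pullbacks and all naturality squares of $m$ are weak pullbacks; $(\mathcal V,\xi)$ is a $\mathbb T$-algebra, and $\otimes:\mathcal V\times\mathcal V\to\mathcal V$ and $k:1\to\mathcal V$ are $\mathbb T$-homomorphisms; and the maps $\mathcal V^X\to\mathcal V^{TX}$, $\varphi\mapsto\xi\cdot T\varphi$, are order preserving and natural in $X$, where $f:X\to Y$ acts on $\mathcal V^X$ by $\varphi\mapsto\bigl(y\mapsto\bigvee_{f(x)=y}\varphi(x)\bigr)$. Assume also $T1\cong 1$. For a matrix $r:Y\times X\to\mathcal V$ put $T_\xi r(\mathfrak y,\mathfrak x)=\bigvee\{\xi(Tr(\mathfrak w))\mid \mathfrak w\in T(Y\times X),\ T\pi_1\mathfrak w=\mathfrak y,\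 T\pi_2\mathfrak w=\mathfrak x\}$. A *$\mathcal T$-graph* is a set $X$ with a map $a:TX\times X\to\mathcal V$ such that $k\le a(e_X(x),x)$ for all $x$; it is a *$\mathcal T$-category* if moreover $T_\xi a(\mathfrak X,\mathfrak y)\otimes a(\mathfrak y,x)\le a(m_X(\mathfrak X),x)$ for all $\mathfrak X\in TTX$, $\mathfrak y\in TX$, $x\in X$. A *$\mathcal T$-graph morphism* $f:(X,a)\to(Y,b)$ is a map with $a(\mathfrak x,x)\le b(Tf(\mathfrak x),f(x))$; between $\mathcal T$-categories it is called a *$\mathcal T$-functor*. The $\mathcal V$-graph underlying $(X,a)$ has homs $a(e_X(x),y)$. A $\mathbb T$-algebra $(I,\alpha)$ is regarded as a $\mathcal T$-graph by giving $(\mathfrak i,i)$ the value $k$ if $\alpha(\mathfrak i)=i$ and $\bot$ otherwise. $\mathcal V$ is a $\mathcal T$-category with structure $(\mathfrak v,v)\mapsto\hom(\xi(\mathfrak v),v)$. For a $\mathcal T$-category $X=(X,a)$ let $\mathcal V^X$ be the set of $\mathcal T$-functors $X\to\mathcal V$. It is a $\mathcal V$-category with $[\varphi,\psi]=\bigwedge_{x\in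 X}\hom(\varphi(x),\psi(x))$, and a $\mathcal T$-graph with structure $$(\mathfrak p,\varphi)\longmapsto\bigwedge_{\substack{\mathfrak q\in T(X\times\mathcal V^X),\,x\in X\\ T\pi_2(\mathfrak q)=\mathfrak p}}\hom\bigl(a(T\pi_1(\mathfrak q),x),\hom(\xi(T\mathrm{ev}(\mathfrak q)),\varphi(x))\bigr),$$ and the $\mathcal V$-graph underlying this $\mathcal T$-graph is that $\mathcal V$-category. For a $\mathcal T$-functor $f:X\to Y$ let $\mathcal V^f:\mathcal V^Y\to\mathcal V^X$, $\varphi\mapsto\varphi\cdot f$. In a $\mathcal V$-category $A$, a *supremum* of a family $(d_i)_{i\in I}$ is an object $s$ with $A(s,y)=\bigwedge_{i}A(d_i,y)$ for all $y$. Let $A,B$ be $\mathcal T$-graphs whose underlying $\mathcal V$-graphs are $\mathcal V$-categories. A *$\mathcal T$-diagram* in $A$ is a $\mathcal T$-graph morphism $D:I\to A$ with $I$ a $\mathbb T$-algebra. A $\mathcal V$-functor $\Phi:A\to B$ is *$\mathcal T$-compatible* if $\Phi\cdot D$ is a $\mathcal T$-diagram for each $\mathcal T$-diagram $D$ in $A$;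 it *preserves $\mathcal T$-suprema* if, for every $\mathcal T$-diagram $D$ in $A$ and every supremum $s$ of $D$, $\Phi(s)$ is a supremum of $\Phi\cdot D$. **Proposition.** For every strict topological theory $\mathcal T$ with $T1\cong1$ and every $\mathcal T$-functor $f:X\to Y$ between $\mathcal T$-categories, the map $\mathcal V^f:\mathcal V^Y\to\mathcal V^X$ is a $\mathcal V$-functor and a $\mathcal T$-graph morphism; it is $\mathcal T$-compatible, and it preserves $\mathcal T$-suprema. In general $\mathcal V^f$ does not preserve all suprema: there are a strict topological theory $\mathcal T$ with $T1\cong1$, a $\mathcal T$-functor $f:X\to Y$, and a family in $\mathcal V^Y$ that has a supremum which $\mathcal V^f$ does not preserve. -/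

import Mathlib

open CategoryTheory CategoryTheory.Limits

universe u

/-- A commutative square whose cone is a weak limit of the cospan `f, g`. -/
def IsWeakPullback {C : Type*} [Category C] {P X Y Z : C}
    (p : P ⟶ X) (q : P ⟶ Y) (f : X ⟶ Z) (g : Y ⟶ Z) : Prop :=
  ∃ h : p ≫ f = q ≫ g, Nonempty (IsWeakLimit (PullbackCone.mk p q h))

/-- In the category of sets a weak pullback reaches every compatible pair of elements. -/
theorem IsWeakPullback.exists_elt {P X Y Z : Type u}
    {p : P ⟶ X} {q : P ⟶ Y} {f : X ⟶ Z} {g : Y ⟶ Z} (h : IsWeakPullback p q f g)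
    (x : X) (y : Y) (hxy : f x = g y) : ∃ w : P, p w = x ∧ q w = y := by
  obtain ⟨hc, ⟨hl⟩⟩ := h
  have e : (↾(fun _ : PUnit.{u + 1} => x)) ≫ f = (↾(fun _ : PUnit.{u + 1} => y)) ≫ g := by
    ext t
    exact hxy
  let s : PullbackCone f g := PullbackCone.mk _ _ e
  refine ⟨hl.lift s PUnit.unit, ?_, ?_⟩
  · have := types_congr_hom (hl.fac s WalkingCospan.left) PUnit.unit
    exact this
  · have := types_congr_hom (hl.fac s WalkingCospan.right) PUnit.unit
    exact this

/-- The internal hom of a commutative quantale: `x * y ≤ z ↔ x ≤ qhom y z`. -/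
def qhom {V : Type u} [CommMonoid V] [CompleteLattice V] [IsQuantale V] (y z : V) : V :=
  Quantale.leftMulResiduation y z

theorem le_qhom {V : Type u} [CommMonoid V] [CompleteLattice V] [IsQuantale V] {x y z : V} :
    x ≤ qhom y z ↔ x * y ≤ z :=
  Quantale.leftMulResiduation_le_iff_mul_le

/-- A strict topological theory over the commutative unital quantale `(V, ⨆, *, 1)`. -/
structure StrictTopologicalTheory
    (V : Type u) [CommMonoid V] [CompleteLattice V] [IsQuantale V] where
  /-- the monad `(T, m, e)` on the category of sets -/
  monad : CategoryTheory.Monad (Type u)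
  /-- the structure map `ξ : T V → V` -/
  xi : monad.obj V → V
  /-- `T` sends pullbacks to weak pullbacks -/
  map_weakPullback : ∀ {P X Y Z : Type u} {p : P ⟶ X} {q : P ⟶ Y} {f : X ⟶ Z} {g : Y ⟶ Z},
    IsPullback p q f g →
      IsWeakPullback (monad.map p) (monad.map q) (monad.map f) (monad.map g)
  /-- the naturality squares of `m` are weak pullbacks -/
  mu_weakPullback : ∀ {X Y : Type u} (f : X ⟶ Y),
    IsWeakPullback (monad.μ.app X) (monad.map (monad.map f)) (monad.map f) (monad.μ.app Y)
  /-- `(V, ξ)` is an algebra: unit law -/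
  xi_unit : ∀ v : V, xi (monad.η.app V v) = v
  /-- `(V, ξ)` is an algebra: associativity law -/
  xi_assoc : ∀ w : monad.obj (monad.obj V), xi (monad.map (↾xi) w) = xi (monad.μ.app V w)
  /-- the multiplication `V × V → V` is a homomorphism of algebras -/
  xi_mul : ∀ w : monad.obj (V × V),
    xi (monad.map (↾(fun p : V × V => p.1 * p.2)) w) =
      xi (monad.map (↾(Prod.fst : V × V → V)) w) * xi (monad.map (↾(Prod.snd : V × V → V)) w)
  /-- the unit `1 → V` is a homomorphism of algebras -/
  xi_one : ∀ w : monad.obj PUnit.{u + 1},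
    xi (monad.map (↾(fun _ : PUnit.{u + 1} => (1 : V))) w) = 1
  /-- each component `φ ↦ ξ · T φ` of the transformation `P_V ⇒ P_V ∘ T` is order preserving -/
  xi_mono : ∀ {X : Type u} (φ ψ : X → V), φ ≤ ψ →
    ∀ x : monad.obj X, xi (monad.map (↾φ) x) ≤ xi (monad.map (↾ψ) x)
  /-- the components `φ ↦ ξ · T φ` are natural, where `P_V f` sends `φ : X → V` to
  `y ↦ ⨆ {φ x | f x = y}`, the left adjoint of precomposition with `f` -/
  xi_natural : ∀ {X Y : Type u} (f : X → Y) (φ : X → V) (y : monad.obj Y),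
    xi (monad.map (↾(fun z : Y => ⨆ (x : X) (_ : f x = z), φ x)) y) =
      ⨆ (x : monad.obj X) (_ : monad.map (↾f) x = y), xi (monad.map (↾φ) x)

namespace StrictTopologicalTheory

variable {V : Type u} [CommMonoid V] [CompleteLattice V] [IsQuantale V]

/-- The set `T X`. -/
abbrev T (Th : StrictTopologicalTheory V) (X : Type u) : Type u := Th.monad.obj X

/-- The function `T f : T X → T Y`. -/
def map (Th : StrictTopologicalTheory V) {X Y : Type u} (f : X → Y) (x : Th.T X) : Th.T Y :=
  Th.monad.map (↾f) x

/-- The unit `e_X : X → T X`. -/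
def e (Th : StrictTopologicalTheory V) {X : Type u} (x : X) : Th.T X := Th.monad.η.app X x

/-- The multiplication `m_X : T T X → T X`. -/
def m (Th : StrictTopologicalTheory V) {X : Type u} (x : Th.T (Th.T X)) : Th.T X :=
  Th.monad.μ.app X x

/-- The standing condition `T 1 = 1`. -/
def PreservesPoint (Th : StrictTopologicalTheory V) : Prop :=
  Nonempty (Th.T PUnit.{u + 1} ≃ PUnit.{u + 1})

/-- The lax extension `T_ξ` on matrices; a `V`-matrix `X ⇸ Y` is a function `Y → X → V`. -/
def laxExt (Th : StrictTopologicalTheory V) {X Y : Type u} (r : Y → X → V) : Th.T Y → Th.T X → V :=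
  fun y x => ⨆ (w : Th.T (Y × X)) (_ : Th.map Prod.fst w = y ∧ Th.map Prod.snd w = x),
    Th.xi (Th.map (fun p : Y × X => r p.1 p.2) w)

/-- The Kleisli composite `β ∘ α = m · T_ξ β · α` of the `T`-matrices `α : X ⇸ T Y` and
`β : Y ⇸ T Z`, with values in `T Z × X`. -/
def kleisli (Th : StrictTopologicalTheory V) {X Y Z : Type u}
    (β : Th.T Z → Y → V) (α : Th.T Y → X → V) : Th.T Z → X → V :=
  fun z x => ⨆ (w : Th.T (Th.T Z)) (_ : Th.m w = z) (y : Th.T Y), Th.laxExt β w y * α y x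

theorem map_map (Th : StrictTopologicalTheory V) {X Y Z : Type u} (g : Y → Z) (f : X → Y)
    (x : Th.T X) : Th.map g (Th.map f x) = Th.map (fun t => g (f t)) x :=
  (Th.monad.toFunctor.map_comp_apply (↾f) (↾g) x).symm

theorem map_e (Th : StrictTopologicalTheory V) {X Y : Type u} (f : X → Y) (x : X) :
    Th.map f (Th.e x) = Th.e (f x) :=
  (types_congr_hom (Th.monad.η.naturality (↾f)) x).symm

/-- A `T`-graph: a set with a `T`-matrix `a : X ⇸ T X` such that `e_X ≤ a`. -/
structure TGraph (Th : StrictTopologicalTheory V) where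
  /-- the underlying set -/
  carrier : Type u
  /-- the entries `a (𝔵, x)` of the structure matrix -/
  str : Th.T carrier → carrier → V
  refl : ∀ x : carrier, 1 ≤ str (Th.e x) x

/-- A `T`-category: a `T`-graph with `a ∘ a ≤ a`. -/
structure TCat (Th : StrictTopologicalTheory V) extends TGraph Th where
  trans : ∀ (x : Th.T carrier) (y : carrier), Th.kleisli str str x y ≤ str x y

/-- `T`-graph morphisms: `T f · a ≤ b · f`. -/
def IsTGraphHom {Th : StrictTopologicalTheory V} (A B : TGraph Th)
    (f : A.carrier → B.carrier) : Prop :=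
  ∀ (x : Th.T A.carrier) (y : A.carrier), A.str x y ≤ B.str (Th.map f x) (f y)

/-- `T`-functors between `T`-categories. -/
structure TFunctor {Th : StrictTopologicalTheory V} (X Y : TCat Th) where
  /-- the underlying function -/
  toFun : X.carrier → Y.carrier
  isHom : IsTGraphHom X.toTGraph Y.toTGraph toFun

/-- The Eilenberg–Moore algebra `(I, α)` as a `T`-graph, with structure matrix `α°`. -/
def algGraph (Th : StrictTopologicalTheory V) (I : Th.monad.Algebra) : TGraph Th where
  carrier := I.A
  str x i := ⨆ _ : I.a x = i, 1
  refl i := le_iSup (fun _ : I.a (Th.e i) = i => (1 : V)) (types_congr_hom I.unit i)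

/-- The quantale `V` as a `T`-category, with structure `(𝔳, v) ↦ hom (ξ 𝔳, v)`. -/
def valueCat (Th : StrictTopologicalTheory V) : TCat Th where
  carrier := V
  str x v := qhom (Th.xi x) v
  refl v := by
    rw [le_qhom, one_mul]
    exact (Th.xi_unit v).le
  trans x v := by
    refine iSup_le fun w => iSup_le fun hw => iSup_le fun y => ?_
    subst hw
    rw [le_qhom]
    have h1 : Th.laxExt (fun (x : Th.T V) (v : V) => qhom (Th.xi x) v) w y *
        Th.xi (Th.m w) ≤ Th.xi y := by
      rw [← le_qhom]
      refine iSup_le fun q => iSup_le fun hq => ?_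
      rw [le_qhom]
      have h2 : Th.xi (Th.m w) = Th.xi (Th.map (fun p : Th.T V × V => Th.xi p.1) q) := by
        rw [← hq.1]
        refine (Th.xi_assoc _).symm.trans (congrArg Th.xi ?_)
        exact Th.map_map Th.xi Prod.fst q
      have h3 := Th.xi_mul
        (Th.map (fun p : Th.T V × V => (qhom (Th.xi p.1) p.2, Th.xi p.1)) q)
      have h4 : Th.map (fun p : V × V => p.1 * p.2)
          (Th.map (fun p : Th.T V × V => (qhom (Th.xi p.1) p.2, Th.xi p.1)) q) =
          Th.map (fun p : Th.T V × V => qhom (Th.xi p.1) p.2 * Th.xi p.1) q := Th.map_map _ _ q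
      have h5 : Th.map (Prod.fst : V × V → V)
          (Th.map (fun p : Th.T V × V => (qhom (Th.xi p.1) p.2, Th.xi p.1)) q) =
          Th.map (fun p : Th.T V × V => qhom (Th.xi p.1) p.2) q := Th.map_map _ _ q
      have h6 : Th.map (Prod.snd : V × V → V)
          (Th.map (fun p : Th.T V × V => (qhom (Th.xi p.1) p.2, Th.xi p.1)) q) =
          Th.map (fun p : Th.T V × V => Th.xi p.1) q := Th.map_map _ _ q
      change Th.xi (Th.map _ _) = Th.xi (Th.map _ _) * Th.xi (Th.map _ _) at h3
      rw [h4, h5, h6] at h3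
      rw [h2, ← h3, ← hq.2]
      exact Th.xi_mono (fun p : Th.T V × V => qhom (Th.xi p.1) p.2 * Th.xi p.1) Prod.snd
        (fun p => le_qhom.1 le_rfl) q
    calc _ = Th.laxExt (fun (x : Th.T V) (v : V) => qhom (Th.xi x) v) w y * Th.xi (Th.m w) *
          qhom (Th.xi y) v := mul_right_comm _ _ _
      _ ≤ Th.xi y * qhom (Th.xi y) v := mul_le_mul_left h1 _
      _ = qhom (Th.xi y) v * Th.xi y := mul_comm _ _
      _ ≤ v := le_qhom.1 le_rfl

end StrictTopologicalTheory

/-- A `V`-category. -/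
structure VCat (V : Type u) [CommMonoid V] [CompleteLattice V] [IsQuantale V] where
  /-- the set of objects -/
  carrier : Type u
  /-- the hom-object from the first to the second argument -/
  hom : carrier → carrier → V
  refl : ∀ x, 1 ≤ hom x x
  trans : ∀ x y z, hom x y * hom y z ≤ hom x z

namespace VCat

variable {V : Type u} [CommMonoid V] [CompleteLattice V] [IsQuantale V]

/-- `V`-functors. -/
def IsVFunctor (A B : VCat V) (f : A.carrier → B.carrier) : Prop :=
  ∀ x y, A.hom x y ≤ B.hom (f x) (f y)

/-- `s` is a supremum (a conical colimit) of the family `D` in the `V`-category `A`. -/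
def IsSupremum (A : VCat V) {I : Type u} (D : I → A.carrier) (s : A.carrier) : Prop :=
  ∀ y, A.hom s y = ⨅ i, A.hom (D i) y

/-- `f` preserves the suprema of all small families. -/
def PreservesSuprema (A B : VCat V) (f : A.carrier → B.carrier) : Prop :=
  ∀ (I : Type u) (D : I → A.carrier) (s : A.carrier),
    A.IsSupremum D s → B.IsSupremum (fun i => f (D i)) (f s)

end VCat

namespace StrictTopologicalTheory

variable {V : Type u} [CommMonoid V] [CompleteLattice V] [IsQuantale V]

/-- A `T`-graph whose underlying `V`-graph, with hom `(x, y) ↦ a (e x, y)`, is a `V`-category. -/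
structure TVGraph (Th : StrictTopologicalTheory V) extends TGraph Th where
  trans : ∀ x y z : carrier, str (Th.e x) y * str (Th.e y) z ≤ str (Th.e x) z

/-- The underlying `V`-category. -/
def TVGraph.toVCat {Th : StrictTopologicalTheory V} (A : TVGraph Th) : VCat V where
  carrier := A.carrier
  hom x y := A.str (Th.e x) y
  refl := A.refl
  trans := A.trans

/-- `f` is a `V`-functor which turns `T`-diagrams into `T`-diagrams. -/
structure TCompatible {Th : StrictTopologicalTheory V} (A B : TVGraph Th)
    (f : A.carrier → B.carrier) : Prop where
  isVFunctor : VCat.IsVFunctor A.toVCat B.toVCat f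
  comp : ∀ (I : Th.monad.Algebra) (h : I.A → A.carrier),
    IsTGraphHom (Th.algGraph I) A.toTGraph h →
      IsTGraphHom (Th.algGraph I) B.toTGraph (fun i => f (h i))

/-- `f` preserves the suprema of `T`-diagrams, that is, of `T`-graph morphisms `D : I → A`
defined on an Eilenberg–Moore algebra `I`. -/
def PreservesTSuprema {Th : StrictTopologicalTheory V} (A B : TVGraph Th)
    (f : A.carrier → B.carrier) : Prop :=
  ∀ (I : Th.monad.Algebra) (D : I.A → A.carrier),
    IsTGraphHom (Th.algGraph I) A.toTGraph D →
      ∀ s : A.carrier, VCat.IsSupremum A.toVCat D s →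
        VCat.IsSupremum B.toVCat (fun i => f (D i)) (f s)

/-- The value in `V` of a `T`-functor `φ : X → V` at `x`. -/
def ev {Th : StrictTopologicalTheory V} {X : TCat Th} (φ : TFunctor X Th.valueCat)
    (x : X.carrier) : V := φ.toFun x

theorem ev_le {Th : StrictTopologicalTheory V} {X : TCat Th} (φ : TFunctor X Th.valueCat)
    (x : Th.T X.carrier) (y : X.carrier) : X.str x y * Th.xi (Th.map (ev φ) x) ≤ ev φ y :=
  le_qhom.1 (φ.isHom x y)

/-- The `V`-category `V^X`: the full subcategory of the `V`-category of covariant `V`-presheaves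
on the underlying `V`-category of `X` given by the `T`-functors `X → V`. -/
def powCat {Th : StrictTopologicalTheory V} (X : TCat Th) : VCat V where
  carrier := TFunctor X Th.valueCat
  hom φ ψ := ⨅ x : X.carrier, qhom (ev φ x) (ev ψ x)
  refl φ := le_iInf fun x => by
    rw [le_qhom, one_mul]
  trans φ ψ χ := le_iInf fun x => by
    rw [le_qhom]
    calc _ ≤ qhom (ev φ x) (ev ψ x) * qhom (ev ψ x) (ev χ x) * ev φ x :=
          mul_le_mul_left (mul_le_mul' (iInf_le _ x) (iInf_le _ x)) _
      _ = qhom (ev φ x) (ev ψ x) * ev φ x * qhom (ev ψ x) (ev χ x) :=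
          mul_right_comm _ _ _
      _ ≤ ev ψ x * qhom (ev ψ x) (ev χ x) := mul_le_mul_left (le_qhom.1 le_rfl) _
      _ = qhom (ev ψ x) (ev χ x) * ev ψ x := mul_comm _ _
      _ ≤ _ := le_qhom.1 le_rfl

/-- The structure matrix of the `T`-graph `V^X`: its value at `(𝔭, φ)` is the infimum of
`hom (a (Tπ₁ 𝔮, x), hom (ξ (T ev 𝔮), φ x))` over `x` in `X` and `𝔮` in `T (X × V^X)` with
`Tπ₂ 𝔮 = 𝔭`. -/
def powStr {Th : StrictTopologicalTheory V} (X : TCat Th)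
    (p : Th.T (TFunctor X Th.valueCat)) (φ : TFunctor X Th.valueCat) : V :=
  ⨅ (q : Th.T (X.carrier × TFunctor X Th.valueCat)) (x : X.carrier) (_ : Th.map Prod.snd q = p),
    qhom (X.str (Th.map Prod.fst q) x)
      (qhom (Th.xi (Th.map (fun r : X.carrier × TFunctor X Th.valueCat => ev r.2 r.1) q))
        (ev φ x))

/-- The `V`-graph underlying the `T`-graph `V^X` is the `V`-category `V^X`. -/
theorem powStr_e {Th : StrictTopologicalTheory V} (X : TCat Th)
    (φ ψ : TFunctor X Th.valueCat) :
    powStr X (Th.e φ) ψ = ⨅ x : X.carrier, qhom (ev φ x) (ev ψ x) := by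
  apply le_antisymm
  · refine le_iInf fun x => ?_
    refine (iInf_le _ (Th.e (x, φ))).trans ((iInf_le _ x).trans
      ((iInf_le _ (Th.map_e _ _)).trans ?_))
    rw [Th.map_e, Th.map_e, show Th.xi (Th.e (ev φ x)) = ev φ x from Th.xi_unit _]
    calc _ = qhom (X.str (Th.e x) x) (qhom (ev φ x) (ev ψ x)) * 1 := (mul_one _).symm
      _ ≤ qhom (X.str (Th.e x) x) (qhom (ev φ x) (ev ψ x)) * X.str (Th.e x) x :=
          mul_le_mul_right (X.refl x) _
      _ ≤ _ := le_qhom.1 le_rfl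
  · refine le_iInf fun q => le_iInf fun x => le_iInf fun hq => ?_
    have hpb : IsPullback (↾(fun x : X.carrier => (x, φ)))
        (↾(fun _ : X.carrier => PUnit.unit.{u + 1}))
        (↾(Prod.snd : X.carrier × TFunctor X Th.valueCat → _))
        (↾(fun _ : PUnit.{u + 1} => φ)) := by
      rw [Types.isPullback_iff]
      refine ⟨rfl, fun a b h => congrArg Prod.fst h.1, fun a b h => ⟨a.1, ?_, rfl⟩⟩
      exact Prod.ext rfl h.symm
    have he : Th.map (fun _ : PUnit.{u + 1} => φ) (Th.e PUnit.unit) = Th.e φ := Th.map_e _ _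
    obtain ⟨z, hz, -⟩ := (Th.map_weakPullback hpb).exists_elt q (Th.e PUnit.unit)
      (hq.trans he.symm)
    change Th.map (fun x : X.carrier => (x, φ)) z = q at hz
    subst hz
    rw [Th.map_map, Th.map_map, le_qhom, le_qhom]
    have hid : Th.map (fun t : X.carrier => t) z = z := Th.monad.toFunctor.map_id_apply _ z
    rw [hid]
    calc _ = (⨅ x : X.carrier, qhom (ev φ x) (ev ψ x)) *
          (X.str z x * Th.xi (Th.map (ev φ) z)) := mul_assoc _ _ _
      _ ≤ qhom (ev φ x) (ev ψ x) * ev φ x := mul_le_mul' (iInf_le _ x) (ev_le φ z x)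
      _ ≤ _ := le_qhom.1 le_rfl

/-- The `T`-graph `V^X`. -/
def powGraph {Th : StrictTopologicalTheory V} (X : TCat Th) : TVGraph Th where
  carrier := TFunctor X Th.valueCat
  str := powStr X
  refl φ := by
    rw [powStr_e]
    exact (powCat X).refl φ
  trans φ ψ χ := by
    simp only [powStr_e]
    exact (powCat X).trans φ ψ χ

theorem powGraph_toVCat {Th : StrictTopologicalTheory V} (X : TCat Th) :
    (powGraph X).toVCat = powCat X := by
  unfold TVGraph.toVCat powCat powGraph
  congr 1
  funext φ ψ
  exact powStr_e X φ ψ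

/-- `V^f : V^Y → V^X`, precomposition with the `T`-functor `f : X → Y`. -/
def powMap {Th : StrictTopologicalTheory V} {X Y : TCat Th} (f : TFunctor X Y)
    (φ : TFunctor Y Th.valueCat) : TFunctor X Th.valueCat where
  toFun x := φ.toFun (f.toFun x)
  isHom x y := by
    have h := (f.isHom x y).trans (φ.isHom (Th.map f.toFun x) (f.toFun y))
    rwa [Th.map_map] at h

end StrictTopologicalTheory

/-! Everything positive rests on suprema of `T`-diagrams in `V^X` being computed pointwise. For a
diagram `D` on an algebra `(I, α)`, naturality of `ξ` along `X × I → X` writes `ξ · T` of the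
pointwise join as a join over `w` in `T (X × I)`; for each `w`, the index `α (Tπ₂ w)` names one
member of `D` that already bounds the corresponding term, because `D` is a graph morphism. So the
pointwise join is a `T`-functor (`diagramSup`), hence a supremum, and suprema have unique values.
Precomposition with `f` keeps pointwise joins. That `V^f` is a graph morphism comes from lifting
along a weak pullback (`exists_map_prod`).

For the negative part take nonempty subsets, the two-element frame and `ξ` = infimum. In
`cosubsingletonCat X` a set with two elements converges everywhere, so functors to `V` amount to
subsets of `X` that are empty, a singleton or all of `X`. Two distinct singletons then have supremum
`X`; restricted to a third point, both become empty while `X` does not. -/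

namespace StrictTopologicalTheory

/-! ### Precomposition preserves `T`-suprema -/

section PowMap

variable {V : Type u} [CommMonoid V] [CompleteLattice V] [IsQuantale V]
  {Th : StrictTopologicalTheory V} {X Y : TCat Th}

theorem powMap_isVFunctor (f : TFunctor X Y) :
    VCat.IsVFunctor (powCat Y) (powCat X) (powMap f) :=
  fun _ _ => le_iInf fun x => iInf_le _ (f.toFun x)

/-- The elements of `T (X × A)` over the image of `p` under `T g` come from `T (X × B)`. -/
theorem exists_map_prod {X A B : Type u} (Th : StrictTopologicalTheory V) (g : B → A)
    (q : Th.T (X × A)) (p : Th.T B) (h : Th.map Prod.snd q = Th.map g p) :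
    ∃ w : Th.T (X × B), Th.map (fun r : X × B => (r.1, g r.2)) w = q ∧ Th.map Prod.snd w = p := by
  -- `X × B` is the pullback of the projection `X × A → A` along `g`, and `T` makes this a weak
  -- pullback.
  have hpb : IsPullback (↾(fun r : X × B => (r.1, g r.2))) (↾(Prod.snd : X × B → B))
      (↾(Prod.snd : X × A → A)) (↾g) := by
    rw [Types.isPullback_iff]
    refine ⟨rfl, fun a b h => ?_, fun a b h => ⟨(a.1, b), Prod.ext rfl h.symm, rfl⟩⟩
    exact Prod.ext (congrArg (fun r : X × A => r.1) h.1) h.2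
  exact (Th.map_weakPullback hpb).exists_elt q p h

/-- Evaluation is dinatural: on `X × V^Y`, evaluating `φ · f` at `x` is evaluating `φ` at `f x`. So
each term of the infimum for `V^X` dominates a term of the infimum for `V^Y`. -/
theorem powMap_isTGraphHom (f : TFunctor X Y) :
    IsTGraphHom (powGraph Y).toTGraph (powGraph X).toTGraph (powMap f) := by
  intro p φ
  refine le_iInf fun q => le_iInf fun x => le_iInf fun hq => ?_
  obtain ⟨w, rfl, rfl⟩ := exists_map_prod Th (powMap f) q p hq
  -- The term to compare with is the image of `w` under `T (f × id)`, taken at the point `f x`.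
  refine (iInf_le _ (Th.map (fun r => (f.toFun r.1, r.2)) w)).trans
    ((iInf_le _ (f.toFun x)).trans ((iInf_le _ (Th.map_map _ _ w)).trans ?_))
  rw [le_qhom, Th.map_map, Th.map_map, Th.map_map, Th.map_map]
  refine le_trans (mul_le_mul_right ?_ _) (le_qhom.1 le_rfl)
  have := f.isHom (Th.map Prod.fst w) x
  rwa [Th.map_map] at this

theorem powMap_tCompatible (f : TFunctor X Y) :
    TCompatible (powGraph Y) (powGraph X) (powMap f) where
  isVFunctor φ ψ := (powStr_e Y φ ψ).trans_le
    ((powMap_isVFunctor f φ ψ).trans_eq (powStr_e X (powMap f φ) (powMap f ψ)).symm)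
  comp I h hh i j := by
    exact ((hh i j).trans (powMap_isTGraphHom f (Th.map h i) (h j))).trans_eq
      (congrArg (powStr X · _) (Th.map_map (powMap f) h i))

/-- The pointwise supremum of a `T`-diagram in `V^X` is a `T`-functor. -/
def diagramSup {I : Th.monad.Algebra} (D : I.A → TFunctor X Th.valueCat)
    (hD : IsTGraphHom (Th.algGraph I) (powGraph X).toTGraph D) : TFunctor X Th.valueCat where
  toFun x := (⨆ i, ev (D i) x : V)
  isHom p x := by
    -- The pointwise join is the direct image of `(x, i) ↦ D i x` along the projection to `X`, the
    -- form to which `xi_natural` applies.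
    have hsup : (fun x => ⨆ i, ev (D i) x) = fun z : X.carrier =>
        ⨆ (r : X.carrier × I.A) (_ : r.1 = z), ev (D r.2) r.1 := by
      funext z
      apply le_antisymm
      · exact iSup_le fun i => le_iSup₂_of_le (z, i) rfl le_rfl
      · refine iSup₂_le fun r hr => ?_
        subst hr
        exact le_iSup (fun i => ev (D i) r.1) r.2
    have hnat := Th.xi_natural (Prod.fst : X.carrier × I.A → X.carrier)
      (fun r => ev (D r.2) r.1) p
    rw [← hsup] at hnat
    refine le_qhom.2 (le_of_eq_of_le (congrArg (fun v : V => X.str p x * v) hnat) ?_)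
    rw [mul_comm, ← le_qhom]
    refine iSup₂_le (α := V) fun w hw => ?_
    rw [le_qhom, mul_comm]
    change Th.map Prod.fst w = p at hw
    subst hw
    -- In `I`, `Tπ₂ w` converges to its algebra value with degree `1`, and `D` preserves this.
    -- Instantiating the infimum at `T (id × D) w` gives the bound for the summand of `w`.
    have h1 : (1 : V) ≤ powStr X (Th.map D (Th.map Prod.snd w)) (D (I.a (Th.map Prod.snd w))) :=
      (le_iSup (fun _ : I.a (Th.map Prod.snd w) = I.a (Th.map Prod.snd w) => (1 : V)) rfl).trans
        (hD (Th.map Prod.snd w) (I.a (Th.map Prod.snd w)))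
    have h2 := h1.trans ((iInf_le _ (Th.map (fun r => (r.1, D r.2)) w)).trans
      ((iInf_le _ x).trans (iInf_le _ (by rw [Th.map_map, Th.map_map]))))
    rw [le_qhom, one_mul, le_qhom, Th.map_map, Th.map_map] at h2
    exact h2.trans (le_iSup (fun i => ev (D i) x) (I.a (Th.map Prod.snd w)))

/-- `hom` turns joins in its first argument into meets, and the two infima commute. -/
theorem isSupremum_of_ev_eq {J : Type u} {D : J → TFunctor X Th.valueCat}
    {s : TFunctor X Th.valueCat} (h : ∀ x, ev s x = ⨆ i, ev (D i) x) :
    (powCat X).IsSupremum D s := by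
  intro ψ
  change ⨅ x, qhom (ev s x) (ev ψ x) = ⨅ i, ⨅ x, qhom (ev (D i) x) (ev ψ x)
  rw [iInf_comm]
  refine iInf_congr fun x => eq_of_forall_le_iff fun c => ?_
  rw [le_qhom, h, Quantale.mul_iSup_distrib]
  simp only [iSup_le_iff, le_iInf_iff, le_qhom]

theorem ev_le_of_one_le_hom {φ ψ : TFunctor X Th.valueCat} (h : 1 ≤ (powCat X).hom φ ψ)
    (x : X.carrier) : ev φ x ≤ ev ψ x := by
  have := h.trans (iInf_le _ x)
  rwa [le_qhom, one_mul] at this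

/-- Two suprema are isomorphic objects of `V^X`, whose order is pointwise, so their values agree by
antisymmetry in `V`. -/
theorem ev_eq_of_isSupremum {J : Type u} {D : J → TFunctor X Th.valueCat}
    {s t : TFunctor X Th.valueCat} (hs : (powCat X).IsSupremum D s)
    (ht : (powCat X).IsSupremum D t) (x : X.carrier) : ev s x = ev t x := by
  apply le_antisymm
  · refine ev_le_of_one_le_hom ?_ x
    rw [hs t, ← ht t]
    exact (powCat X).refl t
  · refine ev_le_of_one_le_hom ?_ x
    rw [ht s, ← hs s]
    exact (powCat X).refl s

theorem isSupremum_powGraph_iff {J : Type u} {D : J → TFunctor X Th.valueCat}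
    {s : TFunctor X Th.valueCat} :
    (powGraph X).toVCat.IsSupremum D s ↔ (powCat X).IsSupremum D s :=
  forall_congr' fun ψ => iff_of_eq <|
    congrArg₂ _ (powStr_e X s ψ) (iInf_congr fun i => powStr_e X (D i) ψ)

theorem powMap_preservesTSuprema (f : TFunctor X Y) :
    PreservesTSuprema (powGraph Y) (powGraph X) (powMap f) := by
  intro I D hD s hs
  refine isSupremum_powGraph_iff.2 (isSupremum_of_ev_eq fun x => ?_)
  exact ev_eq_of_isSupremum (isSupremum_powGraph_iff.1 hs) (t := diagramSup D hD)
    (isSupremum_of_ev_eq fun _ => rfl) (f.toFun x)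

end PowMap

/-! ### A supremum that precomposition does not preserve -/

section NonemptyPowerset

/-- The monad of nonempty subsets. -/
def nonemptyPowerset : CategoryTheory.Monad (Type u) where
  obj X := {s : Set X // s.Nonempty}
  map f := ↾(fun s => ⟨f '' s.1, s.2.image f⟩)
  map_id X := by
    refine ConcreteCategory.hom_ext _ _ fun s => ?_
    exact Subtype.ext (Set.image_id s.1)
  map_comp f g := by
    refine ConcreteCategory.hom_ext _ _ fun s => ?_
    exact Subtype.ext (Set.image_comp g f s.1)
  η :=
    { app := fun X => ↾(fun x => ⟨{x}, Set.singleton_nonempty x⟩)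
      naturality := fun X Y f => by
        refine ConcreteCategory.hom_ext _ _ fun x => ?_
        exact Subtype.ext Set.image_singleton.symm }
  μ :=
    { app := fun X => ↾(fun S => ⟨{x | ∃ s ∈ S.1, x ∈ s.1},
        let ⟨s, hs⟩ := S.2; let ⟨x, hx⟩ := s.2; ⟨x, s, hs, hx⟩⟩)
      naturality := fun X Y f => by
        refine ConcreteCategory.hom_ext _ _ fun S => ?_
        refine Subtype.ext (Set.ext fun y => ?_)
        constructor
        · rintro ⟨_, ⟨s, hs, rfl⟩, x, hx, rfl⟩
          exact ⟨x, ⟨s, hs, hx⟩, rfl⟩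
        · rintro ⟨x, ⟨s, hs, hx⟩, rfl⟩
          exact ⟨_, ⟨s, hs, rfl⟩, x, hx, rfl⟩ }
  assoc X := by
    refine ConcreteCategory.hom_ext _ _ fun S => ?_
    refine Subtype.ext (Set.ext fun y => ?_)
    constructor
    · rintro ⟨_, ⟨s, hs, rfl⟩, t, ht, hx⟩
      exact ⟨t, ⟨s, hs, ht⟩, hx⟩
    · rintro ⟨t, ⟨s, hs, ht⟩, hx⟩
      exact ⟨_, ⟨s, hs, rfl⟩, t, ht, hx⟩
  left_unit X := by
    refine ConcreteCategory.hom_ext _ _ fun s => ?_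
    refine Subtype.ext (Set.ext fun y => ?_)
    constructor
    · rintro ⟨_, rfl, h⟩
      exact h
    · exact fun h => ⟨s, rfl, h⟩
  right_unit X := by
    refine ConcreteCategory.hom_ext _ _ fun s => ?_
    refine Subtype.ext (Set.ext fun y => ?_)
    constructor
    · rintro ⟨_, ⟨x, hx, rfl⟩, rfl⟩
      exact hx
    · exact fun h => ⟨_, ⟨y, h, rfl⟩, rfl⟩

/-- A square of sets that reaches every compatible pair of elements is a weak pullback. -/
theorem isWeakPullback_of_exists_elt {P X Y Z : Type u} {p : P ⟶ X} {q : P ⟶ Y} {f : X ⟶ Z}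
    {g : Y ⟶ Z} (hc : p ≫ f = q ≫ g)
    (h : ∀ (x : X) (y : Y), f x = g y → ∃ w : P, p w = x ∧ q w = y) :
    IsWeakPullback p q f g := by
  have hs (s : PullbackCone f g) (t : s.pt) :
      ∃ w : P, p w = PullbackCone.fst s t ∧ q w = PullbackCone.snd s t :=
    h _ _ (types_congr_hom s.condition t)
  choose l hl hr using hs
  refine ⟨hc, ⟨{ lift := fun s => ↾(l s), fac := fun s j => ?_ }⟩⟩
  have e1 : ↾(l s) ≫ p = PullbackCone.fst s := by
    ext t
    exact hl s t
  have e2 : ↾(l s) ≫ q = PullbackCone.snd s := by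
    ext t
    exact hr s t
  rcases j with _ | _ | _
  · change ↾(l s) ≫ p ≫ f = s.π.app WalkingCospan.one
    rw [← Category.assoc, e1]
    exact s.w WalkingCospan.Hom.inl
  · exact e1
  · exact e2

/-- The strict topological theory of nonempty subsets over a completely distributive lattice,
with structure map the infimum. -/
def nonemptyPowersetTheory (V : Type u) [CommMonoid V] [CompletelyDistribLattice V] [IsQuantale V]
    (hmul : ∀ a b : V, a * b = a ⊓ b) (hone : (1 : V) = ⊤) : StrictTopologicalTheory V where
  monad := nonemptyPowerset
  xi s := sInf s.1
  map_weakPullback {P X Y Z p q f g} h := by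
    obtain ⟨hc, -, hs⟩ := (Types.isPullback_iff _ _ _ _).1 h
    refine isWeakPullback_of_exists_elt
      (by rw [← Functor.map_comp, ← Functor.map_comp, hc]) fun s t hst => ?_
    have hst : f '' s.1 = g '' t.1 := congrArg Subtype.val hst
    -- The witness is the largest candidate: all points of `P` lying over both `s` and `t`. Each
    -- point of one set has a partner in the other since `f '' s = g '' t`.
    have h1 : p '' {w | p w ∈ s.1 ∧ q w ∈ t.1} = s.1 := by
      refine Set.Subset.antisymm (by rintro _ ⟨w, hw, rfl⟩; exact hw.1) fun x hx => ?_
      obtain ⟨y, hy, hxy⟩ := hst.subset ⟨x, hx, rfl⟩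
      obtain ⟨w, rfl, rfl⟩ := hs x y hxy.symm
      exact ⟨w, ⟨hx, hy⟩, rfl⟩
    have h2 : q '' {w | p w ∈ s.1 ∧ q w ∈ t.1} = t.1 := by
      refine Set.Subset.antisymm (by rintro _ ⟨w, hw, rfl⟩; exact hw.2) fun y hy => ?_
      obtain ⟨x, hx, hxy⟩ := hst.superset ⟨y, hy, rfl⟩
      obtain ⟨w, rfl, rfl⟩ := hs x y hxy
      exact ⟨w, ⟨hx, hy⟩, rfl⟩
    have hne : {w | p w ∈ s.1 ∧ q w ∈ t.1}.Nonempty := by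
      rw [← Set.image_nonempty (f := p), h1]
      exact s.2
    exact ⟨⟨_, hne⟩, Subtype.ext h1, Subtype.ext h2⟩
  mu_weakPullback {X Y} f := by
    refine isWeakPullback_of_exists_elt (nonemptyPowerset.μ.naturality f).symm fun A S hAS => ?_
    have hAS : f '' A.1 = {y | ∃ s ∈ S.1, y ∈ s.1} := congrArg Subtype.val hAS
    have him (s) (hs : s ∈ S.1) : f '' (A.1 ∩ f ⁻¹' s.1) = s.1 := by
      rw [Set.image_inter_preimage, hAS]
      exact Set.inter_eq_right.2 fun y hy => ⟨s, hs, hy⟩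
    have hne (s) (hs : s ∈ S.1) : (A.1 ∩ f ⁻¹' s.1).Nonempty := by
      rw [← Set.image_nonempty (f := f), him s hs]
      exact s.2
    -- Cut `A` into the parts lying over the members of `S`; they cover `A`, and each part maps onto
    -- its member because `f '' A` is the union of `S`.
    refine ⟨⟨{t | ∃ s ∈ S.1, t.1 = A.1 ∩ f ⁻¹' s.1}, ?_⟩, Subtype.ext (Set.ext fun x => ?_),
      Subtype.ext (Set.ext fun t => ?_)⟩
    · obtain ⟨s, hs⟩ := S.2
      exact ⟨⟨_, hne s hs⟩, s, hs, rfl⟩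
    · constructor
      · rintro ⟨t, ⟨s, hs, ht⟩, hx⟩
        exact (ht.subset hx).1
      · intro hx
        obtain ⟨s, hs, hxs⟩ := hAS.subset ⟨x, hx, rfl⟩
        exact ⟨⟨_, hne s hs⟩, ⟨s, hs, rfl⟩, hx, hxs⟩
    · constructor
      · rintro ⟨r, ⟨s, hs, hr⟩, rfl⟩
        have : nonemptyPowerset.map f r = s := Subtype.ext ((congrArg (f '' ·) hr).trans (him s hs))
        exact this.symm ▸ hs
      · exact fun ht => ⟨⟨_, hne t ht⟩, ⟨t, ht, rfl⟩, Subtype.ext (him t ht)⟩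
  xi_unit v := sInf_singleton
  xi_assoc S := by
    apply le_antisymm
    · refine le_sInf ?_
      rintro v ⟨s, hs, hv⟩
      exact (sInf_le (Set.mem_image_of_mem _ hs)).trans (sInf_le hv)
    · refine le_sInf ?_
      rintro _ ⟨s, hs, rfl⟩
      exact le_sInf fun v hv => sInf_le ⟨s, hs, hv⟩
  xi_mul w := by
    change sInf ((fun p : V × V => p.1 * p.2) '' w.1) =
      sInf (Prod.fst '' w.1) * sInf (Prod.snd '' w.1)
    simp only [hmul, sInf_image, iInf_inf_eq]
  xi_one w := by
    change sInf ((fun _ => (1 : V)) '' w.1) = 1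
    rw [hone, sInf_image]
    simp
  xi_mono φ ψ h s := by
    change sInf (φ '' s.1) ≤ sInf (ψ '' s.1)
    rw [sInf_image, sInf_image]
    exact iInf₂_mono fun x _ => h x
  xi_natural {X Y} f φ B := by
    change sInf ((fun z : Y => ⨆ (x : X) (_ : f x = z), φ x) '' B.1) =
      ⨆ (A : {s : Set X // s.Nonempty}) (_ : nonemptyPowerset.map (↾f) A = B), sInf (φ '' A.1)
    apply le_antisymm
    · rw [sInf_image, iInf_subtype']
      conv_lhs => simp only [iSup_subtype']
      -- Complete distributivity: the meet of joins is a join over choices `g` of a preimage for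
      -- each point of `B`. The range of `g` is a nonempty set with image `B`, so it indexes a term
      -- on the right.
      rw [iInf_iSup_eq]
      refine iSup_le fun g => ?_
      obtain ⟨b, hb⟩ := B.2
      refine le_iSup₂_of_le (α := V)
        (⟨Set.range fun y => (g y).1, _, ⟨b, hb⟩, rfl⟩ : {s : Set X // s.Nonempty})
        (Subtype.ext (Set.ext fun y => ?_)) ?_
      · constructor
        · rintro ⟨_, ⟨z, rfl⟩, rfl⟩
          exact (congrArg (· ∈ B.1) (g z).2).mpr z.2
        · exact fun hy => ⟨_, ⟨⟨y, hy⟩, rfl⟩, (g ⟨y, hy⟩).2⟩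
      · rw [sInf_image, iInf_range]
    · refine iSup₂_le (α := V) fun A hA => le_sInf ?_
      rintro _ ⟨y, hy, rfl⟩
      subst hA
      obtain ⟨x, hx, rfl⟩ := hy
      exact (sInf_le (Set.mem_image_of_mem φ hx)).trans (le_iSup₂_of_le x rfl le_rfl)

theorem nonemptyPowersetTheory_preservesPoint (V : Type u) [CommMonoid V]
    [CompletelyDistribLattice V] [IsQuantale V]
    (hmul : ∀ a b : V, a * b = a ⊓ b) (hone : (1 : V) = ⊤) :
    (nonemptyPowersetTheory V hmul hone).PreservesPoint := by
  refine ⟨⟨fun _ => PUnit.unit, fun _ => ⟨Set.univ, Set.univ_nonempty⟩, fun s => ?_, fun _ => rfl⟩⟩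
  exact Subtype.ext s.2.eq_univ.symm

/-- A relation between nonempty subsets and points which is reflexive and transitive gives a
category for the theory of nonempty subsets. -/
def relCat (V : Type u) [CommMonoid V] [CompletelyDistribLattice V] [IsQuantale V]
    (hmul : ∀ a b : V, a * b = a ⊓ b) (hone : (1 : V) = ⊤) {X : Type u} (R : Set X → X → V)
    (hrefl : ∀ x, R {x} x = ⊤)
    (htrans : ∀ (w : Set ({s : Set X // s.Nonempty} × X)) (x : X),
      (⨅ p ∈ w, R p.1.1 p.2) ⊓ R (Prod.snd '' w) x ≤ R {z | ∃ p ∈ w, z ∈ p.1.1} x) :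
    TCat (nonemptyPowersetTheory V hmul hone) where
  carrier := X
  str s x := R s.1 x
  refl x := by
    rw [hone]
    exact (hrefl x).ge
  trans s x := by
    refine iSup_le fun S => iSup_le fun hS => iSup_le fun B => ?_
    subst hS
    rw [hmul, laxExt, iSup_inf_eq]
    refine iSup_le fun w => ?_
    rw [iSup_inf_eq]
    refine iSup_le fun ⟨h1, h2⟩ => ?_
    subst h1 h2
    refine le_of_eq_of_le ?_ ((htrans w.1 x).trans_eq ?_)
    · exact congrArg (· ⊓ _) sInf_image
    · refine congrArg (R · x) (Set.ext fun z => ?_)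
      constructor
      · rintro ⟨p, hp, hz⟩
        exact ⟨p.1, ⟨p, hp, rfl⟩, hz⟩
      · rintro ⟨_, ⟨p, hp, rfl⟩, hz⟩
        exact ⟨p, hp, hz⟩

/-- The meet operation of a bounded meet-semilattice as a commutative monoid. -/
abbrev infCommMonoid (L : Type u) [SemilatticeInf L] [OrderTop L] : CommMonoid L where
  mul a b := a ⊓ b
  mul_assoc := inf_assoc
  mul_comm := inf_comm
  one := ⊤
  one_mul := top_inf_eq
  mul_one := inf_top_eq

/-- The monoid structure of the two-element frame `Set PUnit`. -/
local instance : CommMonoid (Set PUnit.{u + 1}) := infCommMonoid _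

local instance : IsQuantale (Set PUnit.{u + 1}) where
  mul_sSup_distrib _ _ := inf_sSup_eq
  sSup_mul_distrib _ _ := sSup_inf_eq

/-- The theory of nonempty subsets over the two-element frame. -/
def boolTheory : StrictTopologicalTheory (Set PUnit.{u + 1}) :=
  nonemptyPowersetTheory _ (fun _ _ => rfl) rfl

/-- The category in which a subset with at least two elements converges to every point, and a
singleton only to its element. -/
def cosubsingletonCat (X : Type u) : TCat boolTheory.{u} :=
  relCat _ (fun _ _ => rfl) rfl (X := X) (fun s x => {_t | x ∈ s ∨ s.Nontrivial})
    (fun _ => Set.eq_univ_of_forall fun _ => Or.inl rfl) <| by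
    rintro w x t ⟨h1, h2⟩
    have h1 (p) (hp : p ∈ w) : p.2 ∈ p.1.1 ∨ p.1.1.Nontrivial := by
      have := Set.mem_iInter₂.1 h1 p hp
      exact this
    have hmono (p) (hp : p ∈ w) : p.1.1 ⊆ {z | ∃ p ∈ w, z ∈ p.1.1} := fun z hz => ⟨p, hp, hz⟩
    -- Either `x` is the limit of a member, whose convergence passes to the larger union, or two
    -- limits differ. In the latter case the union is nontrivial: it contains both limits or a
    -- nontrivial member.
    rcases h2 with ⟨p, hp, rfl⟩ | ⟨_, ⟨p, hp, rfl⟩, _, ⟨q, hq, rfl⟩, hpq⟩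
    · exact (h1 p hp).imp (fun h => hmono p hp h) fun h => h.mono (hmono p hp)
    · rcases h1 p hp with hp' | hp'
      · rcases h1 q hq with hq' | hq'
        · exact Or.inr ⟨_, hmono p hp hp', _, hmono q hq hq', hpq⟩
        · exact Or.inr (hq'.mono (hmono q hq))
      · exact Or.inr (hp'.mono (hmono p hp))

/-- The characteristic function of a point. -/
def pointFunctor {X : Type u} (c : X) :
    TFunctor (cosubsingletonCat X) boolTheory.{u}.valueCat where
  toFun x := ({_t | x = c} : Set PUnit.{u + 1})
  isHom s x := by
    refine le_qhom.2 ?_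
    rintro t ⟨h1, h2⟩
    have h2 (y) (hy : y ∈ s.1) : y = c := Set.mem_sInter.1 h2 _ ⟨y, hy, rfl⟩
    rcases h1 with h1 | ⟨y, hy, z, hz, hyz⟩
    · exact h2 x h1
    · exact absurd ((h2 y hy).trans (h2 z hz).symm) hyz

/-- The constant function with value `⊤`. -/
def topFunctor (X : Type u) : TFunctor (cosubsingletonCat X) boolTheory.{u}.valueCat where
  toFun _ := (⊤ : Set PUnit.{u + 1})
  isHom _ _ := le_qhom.2 le_top

/-- The inclusion of a point. -/
def pointInclusion {X : Type u} (c : X) :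
    TFunctor (cosubsingletonCat PUnit.{u + 1}) (cosubsingletonCat X) where
  toFun _ := c
  isHom s _ := fun _ _ => Or.inl ⟨_, s.2.some_mem, rfl⟩

/-- A functor that holds at two distinct points holds everywhere, because the pair converges to
every point. -/
theorem topFunctor_isSupremum {X : Type u} {J : Type u} (c : J → X) {i j : J}
    (hij : c i ≠ c j) :
    (powCat (cosubsingletonCat X)).IsSupremum (fun i => pointFunctor (c i)) (topFunctor X) := by
  intro ψ
  apply le_antisymm
  · refine le_iInf fun k => le_iInf fun x => (iInf_le _ x).trans (le_qhom.2 ?_)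
    exact (mul_le_mul_right le_top _).trans (le_qhom.1 le_rfl)
  · have hk (k : J) : ⨅ k, (powCat (cosubsingletonCat X)).hom (pointFunctor (c k)) ψ ≤
        ev ψ (c k) := by
      have h := le_qhom.1 ((iInf_le (fun k =>
        (powCat (cosubsingletonCat X)).hom (pointFunctor (c k)) ψ) k).trans (iInf_le _ (c k)))
      exact (le_inf le_rfl fun _ _ => rfl).trans h
    -- Functoriality of `ψ` at the pair `{c i, c j}`: its convergence to `x` has value `⊤`, so `ψ x`
    -- dominates the meet of `ψ (c i)` and `ψ (c j)`.
    refine le_iInf fun x => le_qhom.2 (inf_le_left.trans (le_trans ?_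
      (ev_le ψ (⟨{c i, c j}, _, Or.inl rfl⟩ : {s : Set X // s.Nonempty}) x)))
    refine le_inf (fun _ _ => Or.inr (Set.nontrivial_pair hij)) (le_sInf ?_)
    rintro _ ⟨_, rfl | rfl, rfl⟩
    · exact hk i
    · exact hk j

theorem not_preservesSuprema_powMap_pointInclusion {X : Type u} {a b c : X} (hab : a ≠ b)
    (hac : c ≠ a) (hbc : c ≠ b) :
    ¬ VCat.PreservesSuprema (powCat (cosubsingletonCat X))
      (powCat (cosubsingletonCat PUnit.{u + 1})) (powMap (pointInclusion c)) := by
  intro h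
  -- The test object, the restriction of `pointFunctor a` to `c`, is the bottom function. It bounds
  -- the restricted family, so preservation would put the restriction of `⊤` below it, forcing `c =
  -- a`.
  have hs := h _ _ _ (topFunctor_isSupremum (J := ({a, b} : Set X)) (fun i => i.1)
    (i := ⟨a, Or.inl rfl⟩) (j := ⟨b, Or.inr rfl⟩) hab)
    (powMap (pointInclusion c) (pointFunctor a))
  refine hac (ev_le_of_one_le_hom (le_of_le_of_eq ?_ hs.symm) PUnit.unit (Set.mem_univ PUnit.unit))
  refine le_iInf fun i => le_iInf fun x => le_qhom.2 ?_
  rintro t ⟨-, ht⟩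
  have ht : c = i.1 := ht
  obtain ⟨_, rfl | rfl⟩ := i
  · exact absurd ht hac
  · exact absurd ht hbc

theorem exists_not_preservesSuprema_powMap :
    ∃ (V : Type u) (_ : CommMonoid V) (_ : CompleteLattice V) (_ : IsQuantale V)
      (Th : StrictTopologicalTheory V), Th.PreservesPoint ∧
      ∃ (X Y : TCat Th) (f : TFunctor X Y),
        ¬ VCat.PreservesSuprema (powCat Y) (powCat X) (powMap f) :=
  ⟨Set PUnit.{u + 1}, inferInstance, inferInstance, inferInstance, boolTheory,
    nonemptyPowersetTheory_preservesPoint _ _ _, _, _, pointInclusion (X := ULift.{u} (Fin 3)) ⟨2⟩,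
    not_preservesSuprema_powMap_pointInclusion (a := ⟨0⟩) (b := ⟨1⟩)
      (by simp) (by simp) (by simp)⟩

end NonemptyPowerset
end StrictTopologicalTheory

open StrictTopologicalTheory in
theorem mainTheorem8 :
    (∀ (V : Type u) [CommMonoid V] [CompleteLattice V] [IsQuantale V]
      (Th : StrictTopologicalTheory V), Th.PreservesPoint →
      ∀ (X Y : TCat Th) (f : TFunctor X Y),
        VCat.IsVFunctor (powCat Y) (powCat X) (powMap f) ∧
        IsTGraphHom (powGraph Y).toTGraph (powGraph X).toTGraph (powMap f) ∧
        TCompatible (powGraph Y) (powGraph X) (powMap f) ∧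
        PreservesTSuprema (powGraph Y) (powGraph X) (powMap f)) ∧
    (∃ (V : Type u) (_ : CommMonoid V) (_ : CompleteLattice V) (_ : IsQuantale V)
      (Th : StrictTopologicalTheory V), Th.PreservesPoint ∧
      ∃ (X Y : TCat Th) (f : TFunctor X Y),
        ¬ VCat.PreservesSuprema (powCat Y) (powCat X) (powMap f)) := by
  exact ⟨fun V _ _ _ Th _ X Y f => ⟨powMap_isVFunctor f, powMap_isTGraphHom f,
    powMap_tCompatible f, powMap_preservesTSuprema f⟩, exists_not_preservesSuprema_powMap⟩
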